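/- Theorem 2. Let $K$ be a field (e.g. $\mathbf F_q$), $K[\underline z]$ a polynomial ring in finitely many variables, $\mathfrak r\subseteq K[\underline z]$ an ideal. Consider the polynomial ring $S=K[\underline z,\,t^{-1},\,(G_i)_{i\in\iota}]$, where $t^{-1}$ is the name of a variable, with a monomial ordering $\succ$ (a total ordering of the monomials compatible with multiplication) that is local in $t^{-1}$ and compares the exponents of $t^{-1}$ first: a monomial with smaller exponent of $t^{-1}$ is larger, so $1\succ t^{-1}\succ t^{-2}\succ\cdots$. On the other variables the ordering is arbitrary; in particular it may be a local ordering of $S$. Let $\overline A$ be the ring presented by $\mathfrak r$ with respect to $\succ$, that is, the localization of $K[\underline z]/\mathfrak r$ at the classes of the polynomials with leading monomial $1$ (for a local ordering: the local ring of $K[\underline z]/\mathfrak r$ at the origin; for an ordering that is global on $\underline z$: the ring $K[\underline z]/\mathfrak r$ itself). For an ideal $I\subseteq\overline A$ let $C(I,\overline A)$ be its integral closure, the set of all $x\in\overline A$ with $x^d+a_1x^{d-1}+\cdots+a_d=0$ for some $d$ and $a_j\in I^j$. Let $g_i\in K[\underline z]$ $(i\in\iota)$ be polynomials with levels $w_i\ge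 1$ such that the $g_i$ of level $1$ generate $C(I,\overline A)$ and, for every $k\ge2$, the $g_i$ of level $k$ together with $C(I^{k-1},\overline A)\,C(I,\overline A)$ generate $C(I^k,\overline A)$. The non-homogeneous Rees ring $rees(C(I,\overline A))$ is defined by the ideal of relations \[J=J(I,\overline A)=\mathfrak r\,S+\langle\, g_i-G_i\,t^{-w_i}\ :\ i\in\iota\,\rangle .\] A normal form of $f\in\overline A$ modulo $J$ is a polynomial $r\in S$ such that $f=p/v$ and $up-r\in J$ for some $p,v\in K[\underline z]$, $u\in S$, where $u$ and $v$ have leading monomial $1$, and either $r=0$ or the leading monomial of $r$ is not the leading monomial of an element of $J$. Let $f\in\overline A$. If $\iota$ is finite, then $f$ has a normal form modulo $J$. Moreover (whether or not $\iota$ is finite), for every normal form $r$ of $f$ modulo $J$ and every $k\ge0$, \[f\in C(I^k,\overline A)\iff t^{-k}\text{ divides } r .\] -/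

import Mathlib

open Polynomial in
/-- `z` is integral over the ideal `I`: it is a root of a monic polynomial
`T ^ d + a₁ T ^ (d - 1) + ⋯ + a_d` with `a_j ∈ I ^ j` (so the coefficient of `T ^ i` lies in
`I ^ (d - i)`). -/
def IsIntegralOver {A : Type*} [CommRing A] (I : Ideal A) (z : A) : Prop :=
  ∃ p : A[X], p.Monic ∧ (∀ i, p.coeff i ∈ I ^ (p.natDegree - i)) ∧ p.eval z = 0

open Polynomial in
/-- `z` is integral over `I` iff `z T` is integral over the Rees algebra `⨁ I ^ k T ^ k`. -/
theorem isIntegralOver_iff {A : Type*} [CommRing A] (I : Ideal A) (z : A) :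
    IsIntegralOver I z ↔ IsIntegral (reesAlgebra I) (monomial 1 z : A[X]) := by
  classical
  rcases subsingleton_or_nontrivial A with hA | hA
  · refine ⟨fun _ => ?_, fun _ => ?_⟩
    · rw [Subsingleton.elim (monomial 1 z : A[X]) 0]
      exact isIntegral_zero
    · refine ⟨1, monic_one, fun i => ?_, Subsingleton.elim _ _⟩
      rw [Subsingleton.elim (coeff 1 i : A) 0]
      exact Ideal.zero_mem _
  constructor
  · rintro ⟨p, hp, hc, he⟩
    let b : ℕ → reesAlgebra I := fun i =>
      ⟨monomial (p.natDegree - i) (p.coeff i), reesAlgebra.monomial_mem.mpr (hc i)⟩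
    refine ⟨X ^ p.natDegree + ∑ i ∈ Finset.range p.natDegree, C (b i) * X ^ i,
      monic_X_pow_add ?_, ?_⟩
    · refine lt_of_le_of_lt (degree_sum_le _ _) ?_
      rw [Finset.sup_lt_iff (WithBot.bot_lt_coe _)]
      intro i hi
      exact lt_of_le_of_lt (degree_C_mul_X_pow_le _ _)
        (by exact_mod_cast Finset.mem_range.mp hi)
    · rw [← aeval_def]
      simp only [map_add, map_pow, aeval_X, map_sum, map_mul, aeval_C]
      have hb : ∀ i ∈ Finset.range p.natDegree,
          (algebraMap (reesAlgebra I) A[X]) (b i) * (monomial 1 z) ^ i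
            = monomial p.natDegree (p.coeff i * z ^ i) := by
        intro i hi
        change monomial (p.natDegree - i) (p.coeff i) * (monomial 1 z) ^ i = _
        rw [monomial_pow, monomial_mul_monomial]
        have := Finset.mem_range.mp hi
        rw [show p.natDegree - i + 1 * i = p.natDegree by omega]
      rw [Finset.sum_congr rfl hb, monomial_pow, ← map_sum, one_mul, ← map_add]
      rw [eval_eq_sum_range, Finset.sum_range_succ, hp.coeff_natDegree, one_mul] at he
      rw [add_comm, he, map_zero]
  · rintro ⟨P, hP, he⟩
    set n := P.natDegree with hn
    let a : ℕ → A := fun i => (P.coeff i : A[X]).coeff (n - i)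
    have ha : ∀ i, a i ∈ I ^ (n - i) := fun i => (P.coeff i).2 _
    have hdeg : (∑ i ∈ Finset.range n, C (a i) * X ^ i : A[X]).degree < n := by
      refine lt_of_le_of_lt (degree_sum_le _ _) ?_
      rw [Finset.sup_lt_iff (WithBot.bot_lt_coe _)]
      intro i hi
      exact lt_of_le_of_lt (degree_C_mul_X_pow_le _ _)
        (by exact_mod_cast Finset.mem_range.mp hi)
    have hmon := monic_X_pow_add hdeg
    have hnat : (X ^ n + ∑ i ∈ Finset.range n, C (a i) * X ^ i : A[X]).natDegree = n := by
      rw [natDegree_add_eq_left_of_degree_lt (by rwa [degree_X_pow]), natDegree_X_pow]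
    refine ⟨X ^ n + ∑ i ∈ Finset.range n, C (a i) * X ^ i, hmon, fun i => ?_, ?_⟩
    · rw [hnat]
      rcases lt_or_ge i n with hi | hi
      · have : (X ^ n + ∑ i ∈ Finset.range n, C (a i) * X ^ i : A[X]).coeff i = a i := by
          rw [coeff_add, coeff_X_pow, if_neg hi.ne, zero_add, finsetSum_coeff]
          simp only [coeff_C_mul_X_pow]
          rw [Finset.sum_ite_eq, if_pos (Finset.mem_range.mpr hi)]
        rw [this]
        exact ha i
      · rw [Nat.sub_eq_zero_of_le hi, pow_zero, Ideal.one_eq_top]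
        exact Submodule.mem_top
    · rw [eval₂_eq_sum_range, ← hn, Finset.sum_range_succ, hn, hP.coeff_natDegree, ← hn,
        map_one, one_mul] at he
      have he' := congrArg (fun q : A[X] => q.coeff n) he
      simp only [coeff_add, finsetSum_coeff, coeff_zero, monomial_pow, one_mul,
        coeff_monomial, if_true] at he'
      have hb : ∀ i ∈ Finset.range n,
          ((algebraMap (reesAlgebra I) A[X]) (P.coeff i) * monomial i (z ^ i)).coeff n
            = a i * z ^ i := by
        intro i hi
        have hin : n = (n - i) + i := by
          have := Finset.mem_range.mp hi
          omega
        conv_lhs => rw [hin]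
        rw [coeff_mul_monomial]
        rfl
      rw [Finset.sum_congr rfl hb] at he'
      simp only [eval_add, eval_pow, eval_X, eval_finsetSum, eval_mul, eval_C]
      rw [add_comm]
      exact he'

open Polynomial in
/-- The integral closure `C(I, A)` of the ideal `I` in the ring `A`. -/
def idealClosure {A : Type*} [CommRing A] (I : Ideal A) : Ideal A where
  carrier := {z | IsIntegralOver I z}
  add_mem' {x y} hx hy := by
    simp only [Set.mem_ofPred_eq, isIntegralOver_iff, map_add] at *
    exact hx.add hy
  zero_mem' := by
    simp only [Set.mem_ofPred_eq, isIntegralOver_iff, map_zero]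
    exact isIntegral_zero
  smul_mem' c x hx := by
    simp only [Set.mem_ofPred_eq, isIntegralOver_iff] at *
    have h : (monomial 1 (c • x) : A[X])
        = algebraMap (reesAlgebra I) A[X] (algebraMap A (reesAlgebra I) c) * monomial 1 x := by
      change _ = C c * monomial 1 x
      rw [C_mul_monomial, smul_eq_mul]
    rw [h]
    exact isIntegral_algebraMap.mul hx

/-- A monomial ordering on the monomials in the variables `V` (given by their exponents):
a total ordering compatible with multiplication. It need not be a well-ordering, so
local orderings (all variables `≺ 1`), global and mixed ones are included. -/
structure MonomialOrdering (V : Type*) where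
  /-- `lt a b` means that the monomial with exponent `a` is smaller than that with exponent `b`. -/
  lt : (V →₀ ℕ) → (V →₀ ℕ) → Prop
  strictTotal : IsStrictTotalOrder (V →₀ ℕ) lt
  add_right : ∀ a b c, lt a b → lt (a + c) (b + c)

/-- `m` is the leading (largest) monomial of the polynomial `p`; in particular `p ≠ 0`. -/
def MonomialOrdering.IsLeading {V K : Type*} [Field K] (ord : MonomialOrdering V)
    (p : MvPolynomial V K) (m : V →₀ ℕ) : Prop :=
  m ∈ p.support ∧ ∀ n ∈ p.support, n ≠ m → ord.lt n m

theorem MonomialOrdering.lt_zero_add {V : Type*} (ord : MonomialOrdering V) {a b : V →₀ ℕ}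
    (ha : a ≠ 0 → ord.lt a 0) (hb : b ≠ 0 → ord.lt b 0) (h : a ≠ 0 ∨ b ≠ 0) :
    ord.lt (a + b) 0 := by
  have := ord.strictTotal
  by_cases ha0 : a = 0
  · subst ha0
    simpa using hb (by simpa using h)
  by_cases hb0 : b = 0
  · subst hb0
    simpa using ha ha0
  have h1 := ord.add_right _ _ b (ha ha0)
  rw [zero_add] at h1
  exact _root_.trans h1 (hb hb0)

/-- The polynomials with leading monomial `1`. They become units in the ring that a monomial
ordering is attached to. For a local ordering these are the polynomials with non-zero constant
term, for a global ordering the non-zero constants. -/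
def MonomialOrdering.unitSubmonoid {V : Type*} (K : Type*) [Field K] (ord : MonomialOrdering V) :
    Submonoid (MvPolynomial V K) where
  carrier := {u | ord.IsLeading u 0}
  one_mem' := by
    classical
    refine ⟨by simp, fun n hn hn0 => ?_⟩
    rw [MvPolynomial.mem_support_iff, MvPolynomial.coeff_one] at hn
    exact absurd (by by_contra h; exact hn (if_neg h)) (Ne.symm hn0)
  mul_mem' {u v} hu hv := by
    classical
    have := ord.strictTotal
    have hle : ∀ w : MvPolynomial V K, ord.IsLeading w 0 → ∀ n ∈ w.support, n ≠ 0 → ord.lt n 0 :=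
      fun w hw => hw.2
    refine ⟨?_, fun n hn hn0 => ?_⟩
    · have hu0 := MvPolynomial.mem_support_iff.mp hu.1
      have hv0 := MvPolynomial.mem_support_iff.mp hv.1
      rw [MvPolynomial.mem_support_iff, MvPolynomial.coeff_mul, Finsupp.antidiagonal_zero,
        Finset.sum_singleton]
      exact mul_ne_zero hu0 hv0
    · obtain ⟨a, ha, b, hb, rfl⟩ := Finset.mem_add.mp (MvPolynomial.support_mul u v hn)
      refine ord.lt_zero_add (hle u hu a ha) (hle v hv b hb) ?_
      by_contra! h
      exact hn0 (by rw [h.1, h.2, add_zero])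

/-- The variables of the presentation of the non-homogeneous Rees ring: the variables `coord j`
presenting `Ā`, the variable `t⁻¹`, and one variable `G_i` for each chosen generator `g_i`. -/
inductive ReesVar (σ ι : Type*) where
  | coord (j : σ) : ReesVar σ ι
  | tInv : ReesVar σ ι
  | gen (i : ι) : ReesVar σ ι

/-- A polynomial in the variables presenting `Ā`, as a polynomial in all the variables. -/
noncomputable def liftPoly {σ : Type*} (ι : Type*) {K : Type*} [Field K] :
    MvPolynomial σ K →ₐ[K] MvPolynomial (ReesVar σ ι) K :=
  MvPolynomial.rename ReesVar.coord

/-- The ordering compares the exponents of `t⁻¹` first, and `1 ≻ t⁻¹ ≻ t⁻² ≻ ⋯`. -/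
def MonomialOrdering.TInvLocal {σ ι : Type*} (ord : MonomialOrdering (ReesVar σ ι)) : Prop :=
  ∀ a b : ReesVar σ ι →₀ ℕ, a ReesVar.tInv < b ReesVar.tInv → ord.lt b a

/-- The polynomials in the variables presenting `Ā` that have leading monomial `1`. -/
noncomputable def baseUnits {σ ι : Type*} (K : Type*) [Field K]
    (ord : MonomialOrdering (ReesVar σ ι)) : Submonoid (MvPolynomial σ K) :=
  (ord.unitSubmonoid K).comap (liftPoly (σ := σ) ι (K := K))

/-- The ring `Ā` presented by the relations `rel` with respect to the ordering `ord`: the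
localization of `K[z] / rel` at the polynomials with leading monomial `1`. If the ordering is local,
this is the local ring of `K[z] / rel` at the origin; if it is global on the variables `z`, this is
`K[z] / rel` itself. -/
abbrev PresentedRing {σ ι K : Type*} [Field K] (ord : MonomialOrdering (ReesVar σ ι))
    (rel : Ideal (MvPolynomial σ K)) : Type _ :=
  Localization ((baseUnits K ord).map (Ideal.Quotient.mk rel))

/-- The element of `Ā` represented by a polynomial. -/
noncomputable def toPresentedRing {σ ι K : Type*} [Field K] (ord : MonomialOrdering (ReesVar σ ι))
    (rel : Ideal (MvPolynomial σ K)) : MvPolynomial σ K →+* PresentedRing ord rel :=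
  (algebraMap (MvPolynomial σ K ⧸ rel) (PresentedRing ord rel)).comp (Ideal.Quotient.mk rel)

/-- The data from which the non-homogeneous Rees ring of `C(I, Ā)` is built: polynomials `g i`
with levels `w i ≥ 1` such that those of level `1` generate `C(I, Ā)`, and for `k ≥ 2` those of
level `k` generate `C(I ^ k, Ā)` together with `C(I ^ (k - 1), Ā) C(I, Ā)`. -/
structure IsReesSystem {σ ι K : Type*} [Field K] (ord : MonomialOrdering (ReesVar σ ι))
    (rel : Ideal (MvPolynomial σ K)) (I : Ideal (PresentedRing ord rel))
    (w : ι → ℕ) (g : ι → MvPolynomial σ K) : Prop where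
  one_le : ∀ i, 1 ≤ w i
  level_one : idealClosure I = Ideal.span {x | ∃ i, w i = 1 ∧ x = toPresentedRing ord rel (g i)}
  level : ∀ k, 2 ≤ k → idealClosure (I ^ k) = idealClosure (I ^ (k - 1)) * idealClosure I ⊔
    Ideal.span {x | ∃ i, w i = k ∧ x = toPresentedRing ord rel (g i)}

/-- The ideal of relations defining the non-homogeneous Rees ring of `C(I, Ā)`: it is generated by
the relations of `Ā` and by the relations `g i - G_i t ^ (-w i)`. -/
noncomputable def reesIdeal {σ ι K : Type*} [Field K] (rel : Ideal (MvPolynomial σ K))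
    (w : ι → ℕ) (g : ι → MvPolynomial σ K) : Ideal (MvPolynomial (ReesVar σ ι) K) :=
  rel.map (liftPoly (σ := σ) ι (K := K)) ⊔ Ideal.span (Set.range fun i =>
    liftPoly ι (g i) - MvPolynomial.X (ReesVar.gen i) * MvPolynomial.X ReesVar.tInv ^ w i)

/-- `r` is a (polynomial, weak) normal form of `f ∈ Ā` modulo `J`: `f` is represented by a
fraction `p / v`, there is `u` such that `u p - r ∈ J`, where `u`, `v` have leading monomial `1`,
and either `r = 0` or the leading monomial of `r` is not the leading monomial of an element
of `J`. -/
def IsNormalForm {σ ι K : Type*} [Field K] (ord : MonomialOrdering (ReesVar σ ι))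
    (rel : Ideal (MvPolynomial σ K)) (J : Ideal (MvPolynomial (ReesVar σ ι) K))
    (f : PresentedRing ord rel) (r : MvPolynomial (ReesVar σ ι) K) : Prop :=
  (∃ u ∈ ord.unitSubmonoid K, ∃ v ∈ baseUnits K ord, ∃ p : MvPolynomial σ K,
      toPresentedRing ord rel v * f = toPresentedRing ord rel p ∧ u * liftPoly ι p - r ∈ J) ∧
    ∀ m, ord.IsLeading r m → ¬ ∃ j ∈ J, ord.IsLeading j m

/-!
The idea is that `t⁻¹` measures the filtration of `Ā` by the integral closures `C(I ^ k)`.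

If `f` lies in `C(I ^ k)`, then the generation property of the `g i` writes a unit multiple of `f`
as a combination of products of `g i` of total level at least `k`, and the relations
`g i = G_i t ^ (-w i)` turn it into a multiple of `t⁻ᵏ` (`exists_mul_mem_tInvMultiples`). The
ordering compares exponents of `t⁻¹` first, so if the leading monomial of a normal form `r` had a
smaller exponent of `t⁻¹` than `k`, it would also be the leading monomial of the element
`v r - t⁻ᵏ h` of `J` with `v` of leading monomial `1`, which is excluded. So it is divisible by
`t⁻ᵏ`, and then so are all the smaller monomials of `r` (`pow_tInv_dvd_of_sub_mem`).

Conversely, `t⁻¹ ↦ T⁻¹` and `G_i ↦ g_i T ^ w_i` maps the presentation modulo `J` to the extended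
Rees ring `⨁ C(I ^ n) T ^ n` in `Ā[T, T⁻¹]`; it is a ring because `C(I ^ a) C(I ^ b)` is contained in
`C(I ^ (a + b))`. If `u p` is congruent to `t⁻ᵏ s`, comparing the coefficients of degree `0` gives
`u₀ p ∈ C(I ^ k)`. The element `u₀` need not be a unit of `Ā`, as `u` may involve products such as
`G_i t ^ (-w i)`, but it is a unit modulo `C(I)`, whose elements are nilpotent modulo `C(I ^ k)`;
hence `p ∈ C(I ^ k)` (`mem_idealClosure_of_sub_mem`).

Normal forms exist for arbitrary monomial orderings in finitely many variables
(`MonomialOrdering.exists_weak_normalForm`). As the ordering need not be a well-ordering, division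
may run forever; Mora's remedy is to divide also by the intermediate remainders. Termination rests
on Dickson's lemma for the monomials of the homogenized divisors, and is phrased here as the choice
of a remainder with a maximal set of divisors.
-/

/-! ### Leading monomials -/

namespace MonomialOrdering

variable {V K : Type*} [Field K] (ord : MonomialOrdering V)

theorem lt_irrefl (a : V →₀ ℕ) : ¬ ord.lt a a :=
  have := ord.strictTotal
  irrefl a

variable {ord}

theorem lt_trans {a b c : V →₀ ℕ} (h : ord.lt a b) (h' : ord.lt b c) : ord.lt a c :=
  have := ord.strictTotal
  _root_.trans h h'

theorem lt_asymm {a b : V →₀ ℕ} (h : ord.lt a b) : ¬ ord.lt b a :=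
  fun h' => ord.lt_irrefl a (lt_trans h h')

variable (ord) in
theorem lt_trichotomy (a b : V →₀ ℕ) : ord.lt a b ∨ a = b ∨ ord.lt b a :=
  have := ord.strictTotal
  trichotomous a b

theorem lt_of_add_lt_add_right {a b c : V →₀ ℕ} (h : ord.lt (a + c) (b + c)) : ord.lt a b := by
  rcases ord.lt_trichotomy a b with h' | rfl | h'
  · exact h'
  · exact absurd h (ord.lt_irrefl _)
  · exact absurd h (lt_asymm (ord.add_right _ _ c h'))

theorem exists_min_of_finite {s : Set (V →₀ ℕ)} (hs : s.Finite) (hne : s.Nonempty) :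
    ∃ m ∈ s, ∀ n ∈ s, ¬ ord.lt n m := by
  have := ord.strictTotal
  obtain ⟨m, -, hm⟩ := (hs.wellFoundedOn (r := ord.lt)).has_min Set.univ
    ⟨⟨_, hne.some_mem⟩, trivial⟩
  exact ⟨m, m.2, fun n hn => hm ⟨n, hn⟩ trivial⟩

theorem exists_isLeading {p : MvPolynomial V K} (hp : p ≠ 0) : ∃ m, ord.IsLeading p m := by
  have := ord.strictTotal
  obtain ⟨m, -, hm⟩ := (p.support.finite_toSet.wellFoundedOn (r := Function.swap ord.lt)).has_min
    Set.univ ⟨⟨_, (MvPolynomial.support_nonempty.mpr hp).choose_spec⟩, trivial⟩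
  refine ⟨m, m.2, fun n hn hnm => ?_⟩
  have h := hm ⟨n, hn⟩ trivial
  rcases ord.lt_trichotomy n m with h' | h' | h'
  · exact h'
  · exact absurd h' hnm
  · exact absurd h' h

theorem IsLeading.mul {p q : MvPolynomial V K} {a b : V →₀ ℕ} (hp : ord.IsLeading p a)
    (hq : ord.IsLeading q b) : ord.IsLeading (p * q) (a + b) := by
  classical
  have key : ∀ a' ∈ p.support, ∀ b' ∈ q.support, (a', b') ≠ (a, b) →
      ord.lt (a' + b') (a + b) := by
    intro a' ha' b' hb' hne
    by_cases h : a' = a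
    · subst h
      have hb : b' ≠ b := fun h => hne (by rw [h])
      rw [add_comm a', add_comm a']
      exact ord.add_right _ _ _ (hq.2 b' hb' hb)
    · have h1 := ord.add_right _ _ b' (hp.2 a' ha' h)
      by_cases h' : b' = b
      · rwa [h'] at h1 ⊢
      · refine lt_trans h1 ?_
        rw [add_comm a, add_comm a]
        exact ord.add_right _ _ _ (hq.2 b' hb' h')
  refine ⟨?_, fun n hn hne => ?_⟩
  · rw [MvPolynomial.mem_support_iff, MvPolynomial.coeff_mul, Finset.sum_eq_single (a, b)]
    · exact mul_ne_zero (MvPolynomial.mem_support_iff.mp hp.1)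
        (MvPolynomial.mem_support_iff.mp hq.1)
    · rintro ⟨a', b'⟩ hab hne
      by_contra h0
      have h := key a' (MvPolynomial.mem_support_iff.mpr (left_ne_zero_of_mul h0)) b'
        (MvPolynomial.mem_support_iff.mpr (right_ne_zero_of_mul h0)) hne
      rw [Finset.HasAntidiagonal.mem_antidiagonal.mp hab] at h
      exact ord.lt_irrefl _ h
    · exact fun h => (h (by simp)).elim
  · obtain ⟨a', ha', b', hb', rfl⟩ := Finset.mem_add.mp (MvPolynomial.support_mul p q hn)
    exact key a' ha' b' hb' (by rintro ⟨⟩; exact hne rfl)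

theorem isLeading_monomial (m : V →₀ ℕ) {c : K} (hc : c ≠ 0) :
    ord.IsLeading (MvPolynomial.monomial m c) m := by
  classical
  refine ⟨by simp [hc], fun n hn hne => ?_⟩
  rw [MvPolynomial.support_monomial, if_neg hc, Finset.mem_singleton] at hn
  exact absurd hn hne

theorem IsLeading.sub {p q : MvPolynomial V K} {m : V →₀ ℕ} (hp : ord.IsLeading p m)
    (hq : ∀ n ∈ q.support, ord.lt n m) : ord.IsLeading (p - q) m := by
  classical
  refine ⟨?_, fun n hn hne => ?_⟩
  · have h : q.coeff m = 0 := by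
      by_contra h
      exact ord.lt_irrefl m (hq m (MvPolynomial.mem_support_iff.mpr h))
    rw [MvPolynomial.mem_support_iff, MvPolynomial.coeff_sub, h, sub_zero]
    exact MvPolynomial.mem_support_iff.mp hp.1
  · rcases Finset.mem_union.mp (MvPolynomial.support_sub V p q hn) with h | h
    · exact hp.2 n h hne
    · exact hq n h

/-- Two polynomials with the same leading monomial: a multiple of the second one cancels the
leading term of the first one. -/
theorem IsLeading.exists_cancel {p q : MvPolynomial V K} {m : V →₀ ℕ} (hp : ord.IsLeading p m)
    (hq : ord.IsLeading q m) :
    ∃ c : K, ∀ n ∈ (p - MvPolynomial.C c * q).support, ord.lt n m := by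
  classical
  have hq0 := MvPolynomial.mem_support_iff.mp hq.1
  refine ⟨p.coeff m / q.coeff m, fun n hn => ?_⟩
  have hne : n ≠ m := by
    rintro rfl
    rw [MvPolynomial.mem_support_iff, MvPolynomial.coeff_sub, MvPolynomial.coeff_C_mul,
      div_mul_cancel₀ _ hq0, sub_self] at hn
    exact hn rfl
  rcases Finset.mem_union.mp (MvPolynomial.support_sub V _ _ hn) with h | h
  · exact hp.2 n h hne
  · rw [← MvPolynomial.smul_eq_C_mul] at h
    exact hq.2 n (MvPolynomial.support_smul h) hne

end MonomialOrdering

/-! ### Weak normal forms -/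

/-- Dickson's lemma, as the ascending chain condition for upper sets (`UpperSet` is ordered by
reverse inclusion). -/
theorem UpperSet.wellFoundedLT_of_wellQuasiOrderedLE (α : Type*) [Preorder α]
    [WellQuasiOrderedLE α] : WellFoundedLT (UpperSet α) := by
  refine ⟨RelEmbedding.wellFounded_iff_isEmpty.mpr ⟨fun F => ?_⟩⟩
  have hlt : ∀ m n : ℕ, m < n → F n < F m := fun m n h => F.map_rel_iff.mpr h
  have hx : ∀ n : ℕ, ∃ x, x ∈ F (n + 1) ∧ x ∉ F n := fun n => by
    by_contra! h
    exact (hlt n (n + 1) n.lt_succ_self).not_ge fun x hx => h x hx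
  choose x hx hx' using hx
  obtain ⟨i, j, hij, hle⟩ := wellQuasiOrdered_le x
  have hj : F j ≤ F (i + 1) := by
    rcases (Nat.succ_le_of_lt hij).eq_or_lt with h | h
    · exact (congrArg F h).ge
    · exact (hlt _ _ h).le
  exact hx' j ((F j).upper hle (hj (hx i)))

namespace MonomialOrdering

variable {V K : Type*} [Field K]

/-- The monomials that Mora's algorithm for `f` and `J` is able to reduce once the leading monomial
has dropped to `b`. The divisors in use are the elements of `J` and those polynomials congruent to a
unit multiple of `f` whose leading monomial is larger than `b`. A pair `(m, e)` belongs to the set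
if a divisor with leading monomial dividing `m` has ecart (total degree minus degree of the leading
monomial) at most `e`; as `e` is the exponent of a homogenizing variable, this is an upper set. -/
def moraDivisors (ord : MonomialOrdering V) (J : Ideal (MvPolynomial V K)) (f : MvPolynomial V K)
    (b : V →₀ ℕ) : UpperSet ((V →₀ ℕ) × ℕ) where
  carrier := {x | ∃ g a, ord.IsLeading g a ∧ a ≤ x.1 ∧ g.totalDegree ≤ a.degree + x.2 ∧
    (g ∈ J ∨ (∃ u ∈ ord.unitSubmonoid K, u * f - g ∈ J) ∧ ord.lt b a)}
  upper' := by
    rintro x y hxy ⟨g, a, hg, ha, hd, h⟩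
    exact ⟨g, a, hg, ha.trans hxy.1, hd.trans (Nat.add_le_add_left hxy.2 _), h⟩

/-- Every polynomial has a weak normal form with respect to an arbitrary monomial ordering in
finitely many variables (Mora). -/
theorem exists_weak_normalForm [Finite V] (ord : MonomialOrdering V)
    (J : Ideal (MvPolynomial V K)) (f : MvPolynomial V K) :
    ∃ u ∈ ord.unitSubmonoid K, ∃ r, u * f - r ∈ J ∧
      ∀ m, ord.IsLeading r m → ¬ ∃ j ∈ J, ord.IsLeading j m := by
  classical
  by_contra! H
  -- `M` holds the candidates for a normal form; by assumption all of them can be reduced.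
  set M : Set (MvPolynomial V K) := {h | ∃ u ∈ ord.unitSubmonoid K, u * f - h ∈ J}
  replace H : ∀ h ∈ M, ∃ m, ord.IsLeading h m ∧ ∃ j ∈ J, ord.IsLeading j m := by
    rintro h ⟨u, hu, hh⟩
    exact H u hu h hh
  have hMJ : ∀ h ∈ M, ∀ j ∈ J, h - j ∈ M := by
    rintro h ⟨u, hu, hh⟩ j hj
    exact ⟨u, hu, by rw [← sub_add]; exact J.add_mem hh hj⟩
  have hwf := UpperSet.wellFoundedLT_of_wellQuasiOrderedLE ((V →₀ ℕ) × ℕ)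
  obtain ⟨_, ⟨b, ⟨h₀, hh₀, hb⟩, rfl⟩, hmax⟩ := hwf.wf.has_min
    (moraDivisors ord J f '' {b | ∃ h ∈ M, ord.IsLeading h b})
    (by
      obtain ⟨b, hb, -⟩ := H f ⟨1, one_mem _, by simp⟩
      exact ⟨_, b, ⟨f, ⟨1, one_mem _, by simp⟩, hb⟩, rfl⟩)
  -- Only finitely many monomials have degree at most that of `h₀`.
  obtain ⟨m, ⟨hmb, h, hh, hm, hd⟩, hmin⟩ := exists_min_of_finite (ord := ord)
    (s := {m | (m = b ∨ ord.lt m b) ∧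
      ∃ h ∈ M, ord.IsLeading h m ∧ h.totalDegree ≤ h₀.totalDegree})
    ((Finsupp.finite_of_degree_le h₀.totalDegree).subset (by
      rintro m ⟨-, h, -, hm, hd⟩
      exact (MvPolynomial.le_totalDegree hm.1).trans hd))
    ⟨b, Or.inl rfl, h₀, hh₀, hb, le_rfl⟩
  have hmono : ∀ m', ord.lt m' m → moraDivisors ord J f m' ≤ moraDivisors ord J f b := by
    rintro m' hm' x ⟨g, a, hg, ha, hd, hgJ⟩
    refine ⟨g, a, hg, ha, hd, hgJ.imp_right fun hgM => ⟨hgM.1, lt_trans hm' ?_⟩⟩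
    rcases hmb with rfl | hmb
    · exact hgM.2
    · exact lt_trans hmb hgM.2
  obtain ⟨e, he⟩ := Nat.exists_eq_add_of_le
    (show m.degree ≤ h.totalDegree from MvPolynomial.le_totalDegree hm.1)
  by_cases hred : (m, e) ∈ moraDivisors ord J f b
  · -- A divisor of small ecart is available: reducing `h` by it does not increase the degree.
    obtain ⟨g, a, hg, ham, hgd, hgJ⟩ := hred
    obtain ⟨μ, rfl⟩ := exists_add_of_le ham
    have hgm : ord.IsLeading (MvPolynomial.monomial μ (1 : K) * g) (a + μ) := by
      rw [add_comm a]
      exact (isLeading_monomial μ one_ne_zero).mul hg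
    obtain ⟨c, hlt⟩ := hm.exists_cancel hgm
    have hh' : h - MvPolynomial.C c * (MvPolynomial.monomial μ (1 : K) * g) ∈ M := by
      rcases hgJ with hgJ | ⟨⟨u', hu', hgM⟩, hba⟩
      · exact hMJ h hh _ (J.mul_mem_left _ (J.mul_mem_left _ hgJ))
      · obtain ⟨u, hu, hhu⟩ := hh
        -- The leading monomial has dropped since `g`, so the cofactor `μ` is smaller than `1`
        -- and the coefficient of `f` keeps its leading monomial.
        have hμ : ord.lt μ 0 := by
          refine lt_of_add_lt_add_right (c := a) ?_
          rw [add_comm, zero_add]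
          rcases hmb with h' | h'
          · rwa [h']
          · exact lt_trans h' hba
        refine ⟨u - MvPolynomial.C c * (MvPolynomial.monomial μ (1 : K) * u'),
          IsLeading.sub hu fun n hn => ?_, ?_⟩
        · rw [← MvPolynomial.smul_eq_C_mul] at hn
          have hl : ord.IsLeading (MvPolynomial.monomial μ (1 : K) * u') (μ + 0) :=
            (isLeading_monomial μ one_ne_zero).mul hu'
          rw [add_zero] at hl
          by_cases hnμ : n = μ
          · rwa [hnμ]
          · exact lt_trans (hl.2 n (MvPolynomial.support_smul hn) hnμ) hμ
        · have h1 := J.mul_mem_left (MvPolynomial.C c * MvPolynomial.monomial μ (1 : K)) hgM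
          convert J.sub_mem hhu h1 using 1
          ring
    obtain ⟨m', hm', -⟩ := H _ hh'
    have hm'lt := hlt m' hm'.1
    refine hmin m' ⟨Or.inr ?_, _, hh', hm', ?_⟩ hm'lt
    · rcases hmb with h' | h'
      · rwa [← h']
      · exact lt_trans hm'lt h'
    · refine (MvPolynomial.totalDegree_sub _ _).trans (max_le hd ?_)
      refine le_trans ?_ hd
      refine (MvPolynomial.totalDegree_mul _ _).trans ?_
      rw [MvPolynomial.totalDegree_C, zero_add, he]
      refine (MvPolynomial.totalDegree_mul _ _).trans ?_
      have h1 : (MvPolynomial.monomial μ (1 : K)).totalDegree ≤ μ.degree :=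
        MvPolynomial.totalDegree_monomial_le μ 1
      have h2 : (a + μ).degree = a.degree + μ.degree := map_add _ _ _
      omega
  · -- Otherwise `h` itself becomes a new divisor after one reduction by an element of `J`.
    obtain ⟨m₁, hm₁, j, hj, hjm⟩ := H h hh
    have hmm : m₁ = m := by
      by_contra hne
      exact lt_asymm (hm.2 m₁ hm₁.1 hne) (hm₁.2 m hm.1 (Ne.symm hne))
    subst hmm
    obtain ⟨c, hlt⟩ := hm.exists_cancel hjm
    have hh' := hMJ h hh _ (J.mul_mem_left (MvPolynomial.C c) hj)
    obtain ⟨m', hm', -⟩ := H _ hh'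
    have hm'lt := hlt m' hm'.1
    refine hmax _ ⟨m', ⟨_, hh', hm'⟩, rfl⟩ (lt_of_le_of_ne (hmono m' hm'lt) fun heq => hred ?_)
    rw [← heq]
    exact ⟨h, m₁, hm, le_rfl, he.le, Or.inr ⟨hh, hm'lt⟩⟩

end MonomialOrdering

/-! ### Integral closures of powers of an ideal -/

section IdealClosure

variable {A : Type*} [CommRing A]

open Polynomial in
/-- `z` is integral over `I ^ c` iff `z T ^ c` is integral over the Rees algebra of `I` itself;
this puts the powers of `I` into a single ring. -/
theorem isIntegralOver_pow_iff (I : Ideal A) (c : ℕ) (z : A) :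
    IsIntegralOver (I ^ c) z ↔ IsIntegral (reesAlgebra I) (monomial c z : A[X]) := by
  constructor
  · rintro ⟨p, hp, hc, he⟩
    have hc' : ∀ i, p.coeff i ∈ I ^ (c * (p.natDegree - i)) := fun i => by
      rw [pow_mul]
      exact hc i
    let b : ℕ → reesAlgebra I := fun i =>
      ⟨monomial (c * (p.natDegree - i)) (p.coeff i), reesAlgebra.monomial_mem.mpr (hc' i)⟩
    refine ⟨X ^ p.natDegree + ∑ i ∈ Finset.range p.natDegree, C (b i) * X ^ i,
      monic_X_pow_add ?_, ?_⟩
    · refine lt_of_le_of_lt (degree_sum_le _ _) ?_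
      rw [Finset.sup_lt_iff (WithBot.bot_lt_coe _)]
      intro i hi
      exact lt_of_le_of_lt (degree_C_mul_X_pow_le _ _)
        (by exact_mod_cast Finset.mem_range.mp hi)
    · rw [← aeval_def]
      simp only [map_add, map_pow, aeval_X, map_sum, map_mul, aeval_C]
      have hb : ∀ i ∈ Finset.range p.natDegree,
          (algebraMap (reesAlgebra I) A[X]) (b i) * (monomial c z) ^ i
            = monomial (c * p.natDegree) (p.coeff i * z ^ i) := by
        intro i hi
        change monomial (c * (p.natDegree - i)) (p.coeff i) * (monomial c z) ^ i = _
        rw [monomial_pow, monomial_mul_monomial, ← mul_add,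
          Nat.sub_add_cancel (Finset.mem_range.mp hi).le]
      rw [Finset.sum_congr rfl hb, monomial_pow, ← map_sum, ← map_add]
      rw [eval_eq_sum_range, Finset.sum_range_succ, hp.coeff_natDegree, one_mul] at he
      rw [add_comm, he, map_zero]
  · rintro ⟨P, hP, he⟩
    rcases subsingleton_or_nontrivial A with hA | hA
    · exact ⟨1, monic_one, fun i => by rw [Subsingleton.elim (coeff 1 i : A) 0]; exact zero_mem _,
        Subsingleton.elim _ _⟩
    set n := P.natDegree with hn
    -- The coefficient of `T ^ (c * n)` of the equation for `z T ^ c` is an equation for `z`.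
    let a : ℕ → A := fun i => (P.coeff i : A[X]).coeff (c * (n - i))
    have ha : ∀ i, a i ∈ (I ^ c) ^ (n - i) := fun i => by
      rw [← pow_mul]
      exact (P.coeff i).2 _
    have hdeg : (∑ i ∈ Finset.range n, C (a i) * X ^ i : A[X]).degree < n := by
      refine lt_of_le_of_lt (degree_sum_le _ _) ?_
      rw [Finset.sup_lt_iff (WithBot.bot_lt_coe _)]
      intro i hi
      exact lt_of_le_of_lt (degree_C_mul_X_pow_le _ _)
        (by exact_mod_cast Finset.mem_range.mp hi)
    have hnat : (X ^ n + ∑ i ∈ Finset.range n, C (a i) * X ^ i : A[X]).natDegree = n := by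
      rw [natDegree_add_eq_left_of_degree_lt (by rwa [degree_X_pow]), natDegree_X_pow]
    refine ⟨X ^ n + ∑ i ∈ Finset.range n, C (a i) * X ^ i, monic_X_pow_add hdeg,
      fun i => ?_, ?_⟩
    · rw [hnat]
      rcases lt_or_ge i n with hi | hi
      · have : (X ^ n + ∑ i ∈ Finset.range n, C (a i) * X ^ i : A[X]).coeff i = a i := by
          rw [coeff_add, coeff_X_pow, if_neg hi.ne, zero_add, finsetSum_coeff]
          simp only [coeff_C_mul_X_pow]
          rw [Finset.sum_ite_eq, if_pos (Finset.mem_range.mpr hi)]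
        rw [this]
        exact ha i
      · rw [Nat.sub_eq_zero_of_le hi, pow_zero, Ideal.one_eq_top]
        exact Submodule.mem_top
    · rw [eval₂_eq_sum_range, ← hn, Finset.sum_range_succ, hn, hP.coeff_natDegree, ← hn,
        map_one, one_mul] at he
      have he' := congrArg (fun q : A[X] => q.coeff (c * n)) he
      simp only [coeff_add, finsetSum_coeff, coeff_zero, monomial_pow,
        coeff_monomial, if_true] at he'
      have hb : ∀ i ∈ Finset.range n,
          ((algebraMap (reesAlgebra I) A[X]) (P.coeff i) * monomial (c * i) (z ^ i)).coeff (c * n)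
            = a i * z ^ i := by
        intro i hi
        rw [show c * n = c * (n - i) + c * i by
          rw [← mul_add, Nat.sub_add_cancel (Finset.mem_range.mp hi).le], coeff_mul_monomial]
        rfl
      rw [Finset.sum_congr rfl hb] at he'
      simp only [eval_add, eval_pow, eval_X, eval_finsetSum, eval_mul, eval_C]
      rw [add_comm]
      exact he'

theorem mem_idealClosure {I : Ideal A} {z : A} : z ∈ idealClosure I ↔ IsIntegralOver I z :=
  Iff.rfl

theorem mul_mem_idealClosure_pow {I : Ideal A} {a b : ℕ} {x y : A}
    (hx : x ∈ idealClosure (I ^ a)) (hy : y ∈ idealClosure (I ^ b)) :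
    x * y ∈ idealClosure (I ^ (a + b)) := by
  rw [mem_idealClosure, isIntegralOver_pow_iff] at *
  rw [← Polynomial.monomial_mul_monomial]
  exact hx.mul hy

theorem idealClosure_mono {I J : Ideal A} (h : I ≤ J) : idealClosure I ≤ idealClosure J :=
  fun _ ⟨p, hp, hc, he⟩ => ⟨p, hp, fun i => Ideal.pow_right_mono h _ (hc i), he⟩

theorem idealClosure_pow_zero (I : Ideal A) : idealClosure (I ^ 0) = ⊤ := by
  rw [Ideal.eq_top_iff_one, mem_idealClosure, isIntegralOver_pow_iff, Polynomial.monomial_zero_one]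
  exact isIntegral_one

theorem pow_mem_idealClosure_pow {I : Ideal A} {x : A} (hx : x ∈ idealClosure I) (k : ℕ) :
    x ^ k ∈ idealClosure (I ^ k) := by
  induction k with
  | zero => rw [idealClosure_pow_zero]; trivial
  | succ k ih =>
    rw [pow_succ x]
    exact mul_mem_idealClosure_pow (b := 1) ih (by rwa [pow_one])

/-- The elements of `C(I)` are nilpotent modulo `C(I ^ k)`, so a unit plus such an element may be
cancelled. -/
theorem mem_idealClosure_pow_of_mul_mem {I : Ideal A} {k : ℕ} {a u x : A} (hu : IsUnit u)
    (hau : a - u ∈ idealClosure I) (h : a * x ∈ idealClosure (I ^ k)) :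
    x ∈ idealClosure (I ^ k) := by
  rw [← Ideal.Quotient.eq_zero_iff_mem] at h ⊢
  have hnil : IsNilpotent (Ideal.Quotient.mk (idealClosure (I ^ k)) (a - u)) :=
    ⟨k, by
      rw [← map_pow, Ideal.Quotient.eq_zero_iff_mem]
      exact pow_mem_idealClosure_pow hau k⟩
  have hunit := hnil.isUnit_add_left_of_commute
    (hu.map (Ideal.Quotient.mk (idealClosure (I ^ k)))) (.all _ _)
  rw [← map_add, add_sub_cancel] at hunit
  rw [map_mul] at h
  exact hunit.mul_right_eq_zero.mp h

end IdealClosure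

/-! ### Specialization to the extended Rees ring -/

section Rees

variable {σ ι K : Type*} [Field K] {ord : MonomialOrdering (ReesVar σ ι)}
  {rel : Ideal (MvPolynomial σ K)} {I : Ideal (PresentedRing ord rel)}
  {w : ι → ℕ} {g : ι → MvPolynomial σ K}

theorem IsReesSystem.gen_mem (hg : IsReesSystem ord rel I w g) (i : ι) :
    toPresentedRing ord rel (g i) ∈ idealClosure (I ^ w i) := by
  rcases (hg.one_le i).eq_or_lt with h | h
  · rw [← h, pow_one, hg.level_one]
    exact Ideal.subset_span ⟨i, h.symm, rfl⟩
  · rw [hg.level _ h]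
    exact Ideal.mem_sup_right (Ideal.subset_span ⟨i, rfl, rfl⟩)

open LaurentPolynomial in
/-- The homomorphism from the presentation to the extended Rees ring inside `Ā[T, T⁻¹]`:
`t⁻¹ ↦ T⁻¹` and `G_i ↦ g_i T ^ w_i`. -/
noncomputable def toLaurent (ord : MonomialOrdering (ReesVar σ ι)) (rel : Ideal (MvPolynomial σ K))
    (w : ι → ℕ) (g : ι → MvPolynomial σ K) :
    MvPolynomial (ReesVar σ ι) K →+* (PresentedRing ord rel)[T;T⁻¹] :=
  MvPolynomial.eval₂Hom
    (LaurentPolynomial.C.comp ((toPresentedRing ord rel).comp MvPolynomial.C))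
    fun
      | .coord j => LaurentPolynomial.C (toPresentedRing ord rel (MvPolynomial.X j))
      | .tInv => LaurentPolynomial.T (-1)
      | .gen i => LaurentPolynomial.C (toPresentedRing ord rel (g i)) * LaurentPolynomial.T (w i)

theorem toLaurent_X_coord (j : σ) : toLaurent ord rel w g (MvPolynomial.X (.coord j)) =
    LaurentPolynomial.C (toPresentedRing ord rel (MvPolynomial.X j)) :=
  MvPolynomial.eval₂Hom_X' _ _ _

theorem toLaurent_X_tInv : toLaurent ord rel w g (MvPolynomial.X .tInv) =
    LaurentPolynomial.T (-1) :=
  MvPolynomial.eval₂Hom_X' _ _ _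

theorem toLaurent_X_gen (i : ι) : toLaurent ord rel w g (MvPolynomial.X (.gen i)) =
    LaurentPolynomial.C (toPresentedRing ord rel (g i)) * LaurentPolynomial.T (w i) :=
  MvPolynomial.eval₂Hom_X' _ _ _

theorem toLaurent_C (c : K) : toLaurent ord rel w g (MvPolynomial.C c) =
    LaurentPolynomial.C (toPresentedRing ord rel (MvPolynomial.C c)) :=
  MvPolynomial.eval₂Hom_C _ _ _

theorem toLaurent_liftPoly (p : MvPolynomial σ K) : toLaurent ord rel w g (liftPoly ι p) =
    LaurentPolynomial.C (toPresentedRing ord rel p) := by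
  induction p using MvPolynomial.induction_on with
  | C c =>
    rw [liftPoly, MvPolynomial.rename_C, toLaurent_C]
  | add p q hp hq => rw [map_add, map_add, hp, hq, map_add, map_add]
  | mul_X p j hp =>
    rw [map_mul, map_mul, hp, map_mul, map_mul, liftPoly, MvPolynomial.rename_X,
      toLaurent_X_coord]

theorem toPresentedRing_eq_zero {p : MvPolynomial σ K} (hp : p ∈ rel) :
    toPresentedRing ord rel p = 0 := by
  rw [toPresentedRing, RingHom.comp_apply, Ideal.Quotient.eq_zero_iff_mem.mpr hp, map_zero]

theorem reesIdeal_le_ker_toLaurent : reesIdeal rel w g ≤ RingHom.ker (toLaurent ord rel w g) := by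
  refine sup_le (Ideal.map_le_iff_le_comap.mpr fun p hp => ?_) (Ideal.span_le.mpr ?_)
  · change toLaurent ord rel w g (liftPoly ι p) = 0
    rw [toLaurent_liftPoly, toPresentedRing_eq_zero hp, map_zero]
  · rintro _ ⟨i, rfl⟩
    change toLaurent ord rel w g _ = 0
    rw [map_sub, map_mul, map_pow, toLaurent_liftPoly, toLaurent_X_gen, toLaurent_X_tInv,
      LaurentPolynomial.T_pow, mul_assoc, ← LaurentPolynomial.T_add]
    simp

theorem LaurentPolynomial.coeff_mul_C_mul_T {A : Type*} [CommRing A] (x : LaurentPolynomial A)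
    (a : A) (n m : ℤ) :
    (x * (LaurentPolynomial.C a * LaurentPolynomial.T n)).coeff m = x.coeff (m - n) * a := by
  rw [← LaurentPolynomial.single_eq_C_mul_T, AddMonoidAlgebra.coeff_mul_single_apply,
    sub_eq_add_neg]

theorem coord_injective : Function.Injective (ReesVar.coord : σ → ReesVar σ ι) :=
  fun _ _ h => by injection h

/-- The image of the presentation lies in `⨁ C(I ^ n) T ^ n`, and modulo `C(I)` its part of degree
`0` is obtained by setting `t⁻¹` and all the `G_i` equal to zero. -/
theorem toLaurent_coeff_mem (hg : IsReesSystem ord rel I w g)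
    (s : MvPolynomial (ReesVar σ ι) K) :
    (∀ n : ℤ, (toLaurent ord rel w g s).coeff n ∈ idealClosure (I ^ n.toNat)) ∧
      (toLaurent ord rel w g s).coeff 0 -
        toPresentedRing ord rel (MvPolynomial.killCompl coord_injective s) ∈ idealClosure I := by
  have hanti : ∀ {a b : ℕ}, a ≤ b → idealClosure (I ^ b) ≤ idealClosure (I ^ a) :=
    fun h => idealClosure_mono (Ideal.pow_le_pow_right h)
  induction s using MvPolynomial.induction_on with
  | C c =>
    rw [toLaurent_C, MvPolynomial.killCompl_C]
    refine ⟨fun n => ?_, by simp⟩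
    rw [LaurentPolynomial.C_apply]
    split_ifs with h
    · rw [h, Int.toNat_zero, idealClosure_pow_zero]
      trivial
    · exact zero_mem _
  | add p q hp hq =>
    simp only [map_add]
    refine ⟨fun n => add_mem (hp.1 n) (hq.1 n), ?_⟩
    have h := add_mem hp.2 hq.2
    rwa [sub_add_sub_comm] at h
  | mul_X p v hp =>
    obtain ⟨hp, hp0⟩ := hp
    rw [map_mul, map_mul]
    cases v with
    | coord j =>
      have hX : MvPolynomial.killCompl coord_injective
          (MvPolynomial.X (ReesVar.coord (ι := ι) j) : MvPolynomial (ReesVar σ ι) K) =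
            MvPolynomial.X j := by
        rw [← MvPolynomial.rename_X (R := K) (ReesVar.coord (ι := ι)) j,
          MvPolynomial.killCompl_rename_app]
      have hc := fun n => LaurentPolynomial.coeff_mul_C_mul_T (toLaurent ord rel w g p)
        (toPresentedRing ord rel (MvPolynomial.X j)) 0 n
      simp only [LaurentPolynomial.T_zero, mul_one, sub_zero] at hc
      rw [toLaurent_X_coord, hX]
      refine ⟨fun n => ?_, ?_⟩
      · rw [hc]
        exact Ideal.mul_mem_right _ _ (hp n)
      · rw [hc, map_mul, ← sub_mul]
        exact Ideal.mul_mem_right _ _ hp0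
    | tInv =>
      have hX : MvPolynomial.killCompl coord_injective
          (MvPolynomial.X ReesVar.tInv : MvPolynomial (ReesVar σ ι) K) = 0 := by
        simp [MvPolynomial.killCompl]
      have hc := fun n => LaurentPolynomial.coeff_mul_C_mul_T (toLaurent ord rel w g p) 1 (-1) n
      simp only [map_one, one_mul, mul_one] at hc
      rw [toLaurent_X_tInv, hX, mul_zero, map_zero (toPresentedRing ord rel), sub_zero]
      refine ⟨fun n => ?_, ?_⟩
      · rw [hc]
        exact hanti (by omega) (hp _)
      · rw [hc]
        simpa using hp 1
    | gen i =>
      have hX : MvPolynomial.killCompl coord_injective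
          (MvPolynomial.X (ReesVar.gen i) : MvPolynomial (ReesVar σ ι) K) = 0 := by
        simp [MvPolynomial.killCompl]
      rw [toLaurent_X_gen, hX, mul_zero, map_zero (toPresentedRing ord rel), sub_zero]
      have hgi := hg.gen_mem i
      refine ⟨fun n => ?_, ?_⟩
      · rw [LaurentPolynomial.coeff_mul_C_mul_T]
        exact hanti (by omega) (mul_mem_idealClosure_pow (hp _) hgi)
      · rw [LaurentPolynomial.coeff_mul_C_mul_T]
        have h := hanti (hg.one_le i) hgi
        rw [pow_one] at h
        exact Ideal.mul_mem_left _ _ h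

theorem isUnit_toPresentedRing {v : MvPolynomial σ K} (hv : v ∈ baseUnits K ord) :
    IsUnit (toPresentedRing ord rel v) :=
  IsLocalization.map_units (PresentedRing ord rel)
    (⟨_, v, hv, rfl⟩ : (baseUnits K ord).map (Ideal.Quotient.mk rel))

theorem killCompl_mem_baseUnits {u : MvPolynomial (ReesVar σ ι) K} (hu : u ∈ ord.unitSubmonoid K) :
    MvPolynomial.killCompl coord_injective u ∈ baseUnits K ord := by
  classical
  have key : ∀ m : σ →₀ ℕ, (liftPoly ι (MvPolynomial.killCompl coord_injective u)).coeff
      (m.mapDomain ReesVar.coord) = u.coeff (m.mapDomain ReesVar.coord) := fun m => by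
    rw [liftPoly, MvPolynomial.coeff_rename_mapDomain _ coord_injective,
      MvPolynomial.coeff_killCompl]
  refine ⟨?_, fun n hn hne => hu.2 n ?_ hne⟩
  · rw [MvPolynomial.mem_support_iff]
    have h := key 0
    rw [Finsupp.mapDomain_zero] at h
    exact h ▸ MvPolynomial.mem_support_iff.mp hu.1
  · rw [MvPolynomial.mem_support_iff] at hn ⊢
    obtain ⟨m, rfl, -⟩ := MvPolynomial.coeff_rename_ne_zero _ _ _ hn
    exact key m ▸ hn

/-- If a unit multiple of a representative of `f` is congruent modulo the relations to a multiple
of `t⁻ᵏ`, then `f` lies in `C(I ^ k)`. -/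
theorem mem_idealClosure_of_sub_mem (hg : IsReesSystem ord rel I w g)
    {u s : MvPolynomial (ReesVar σ ι) K} (hu : u ∈ ord.unitSubmonoid K) {p : MvPolynomial σ K}
    {k : ℕ} (h : u * liftPoly ι p - MvPolynomial.X ReesVar.tInv ^ k * s ∈ reesIdeal rel w g) :
    toPresentedRing ord rel p ∈ idealClosure (I ^ k) := by
  obtain ⟨-, hu0⟩ := toLaurent_coeff_mem hg u
  refine mem_idealClosure_pow_of_mul_mem (isUnit_toPresentedRing (killCompl_mem_baseUnits hu))
    hu0 ?_
  have h0 : toLaurent ord rel w g _ = 0 := reesIdeal_le_ker_toLaurent h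
  rw [map_sub, sub_eq_zero, map_mul, map_mul, map_pow, toLaurent_liftPoly, toLaurent_X_tInv,
    LaurentPolynomial.T_pow] at h0
  have h1 := congrArg (fun x => x.coeff 0) h0
  have hl := LaurentPolynomial.coeff_mul_C_mul_T (toLaurent ord rel w g u)
    (toPresentedRing ord rel p) 0 0
  have hr := LaurentPolynomial.coeff_mul_C_mul_T (toLaurent ord rel w g s) 1 (k * (-1)) 0
  simp only [LaurentPolynomial.T_zero, mul_one, sub_zero, map_one, one_mul] at hl hr
  rw [mul_comm (LaurentPolynomial.T _)] at h1
  simp only [hl, hr] at h1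
  rw [h1]
  simpa using (toLaurent_coeff_mem hg s).1 k

/-! ### Representing elements of the integral closures by multiples of powers of `t⁻¹` -/

/-- The polynomials in the variables of `Ā` that are congruent to a multiple of `t⁻ᵏ` modulo the
relations of the Rees ring. -/
noncomputable def tInvMultiples (rel : Ideal (MvPolynomial σ K)) (w : ι → ℕ)
    (g : ι → MvPolynomial σ K) (k : ℕ) : Ideal (MvPolynomial σ K) :=
  (reesIdeal rel w g ⊔ Ideal.span {MvPolynomial.X ReesVar.tInv ^ k}).comap (liftPoly (σ := σ) ι)

theorem gen_mem_tInvMultiples (i : ι) : g i ∈ tInvMultiples rel w g (w i) := by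
  rw [tInvMultiples, Ideal.mem_comap, ← sub_add_cancel (liftPoly ι (g i))
    (MvPolynomial.X (ReesVar.gen i) * MvPolynomial.X ReesVar.tInv ^ w i)]
  exact add_mem
    (Ideal.mem_sup_left (Ideal.mem_sup_right (Ideal.subset_span ⟨i, rfl⟩)))
    (Ideal.mem_sup_right (Ideal.mul_mem_left _ _ (Ideal.mem_span_singleton_self _)))

theorem Ideal.sup_span_singleton_mul_sup_span_singleton_le {R : Type*} [CommRing R] (J : Ideal R)
    (a b : R) : (J ⊔ Ideal.span {a}) * (J ⊔ Ideal.span {b}) ≤ J ⊔ Ideal.span {a * b} := by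
  have h₁ : J * (J ⊔ Ideal.span {b}) ≤ J := Ideal.mul_le_left
  have h₂ : Ideal.span {a} * J ≤ J := Ideal.mul_le_right
  rw [Ideal.sup_mul, Ideal.mul_sup (Ideal.span {a}), Ideal.span_singleton_mul_span_singleton]
  exact sup_le (le_sup_of_le_left h₁) (sup_le_sup_right h₂ _)

theorem tInvMultiples_mul_le (k l : ℕ) :
    tInvMultiples rel w g k * tInvMultiples rel w g l ≤ tInvMultiples rel w g (k + l) := by
  refine (Ideal.le_comap_mul _).trans (Ideal.comap_mono ?_)
  rw [pow_add]
  exact Ideal.sup_span_singleton_mul_sup_span_singleton_le _ _ _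

theorem idealClosure_le_map_tInvMultiples (hg : IsReesSystem ord rel I w g) (k : ℕ) :
    idealClosure (I ^ k) ≤ (tInvMultiples rel w g k).map (toPresentedRing ord rel) := by
  have hgen : ∀ k, Ideal.span {x | ∃ i, w i = k ∧ x = toPresentedRing ord rel (g i)} ≤
      (tInvMultiples rel w g k).map (toPresentedRing ord rel) := by
    refine fun k => Ideal.span_le.mpr ?_
    rintro _ ⟨i, rfl, rfl⟩
    exact Ideal.mem_map_of_mem _ (gen_mem_tInvMultiples i)
  have hone : idealClosure I ≤ (tInvMultiples rel w g 1).map (toPresentedRing ord rel) := by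
    rw [hg.level_one]
    exact hgen 1
  rcases k with _ | k
  · have h : tInvMultiples rel w g 0 = ⊤ := by
      rw [tInvMultiples, pow_zero, Ideal.span_singleton_one, sup_top_eq, Ideal.comap_top]
    rw [h, Ideal.map_top]
    exact le_top
  induction k with
  | zero => rwa [zero_add, pow_one]
  | succ k ih =>
    rw [hg.level _ (Nat.le_add_left 2 k)]
    refine sup_le ?_ (hgen _)
    refine (Ideal.mul_mono ih hone).trans ?_
    rw [← Ideal.map_mul]
    exact Ideal.map_mono (tInvMultiples_mul_le _ _)

/-- Clearing the denominators in `Ā`: an element of `C(I ^ k)` represented by a polynomial `p` has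
a unit multiple that is congruent to a multiple of `t⁻ᵏ`. -/
theorem exists_mul_mem_tInvMultiples (hg : IsReesSystem ord rel I w g) {k : ℕ}
    {p : MvPolynomial σ K} (hp : toPresentedRing ord rel p ∈ idealClosure (I ^ k)) :
    ∃ v ∈ baseUnits K ord, v * p ∈ tInvMultiples rel w g k := by
  have h := idealClosure_le_map_tInvMultiples hg k hp
  rw [toPresentedRing, ← Ideal.map_map, RingHom.comp_apply,
    IsLocalization.algebraMap_mem_map_algebraMap_iff
      ((baseUnits K ord).map (Ideal.Quotient.mk rel))] at h
  obtain ⟨_, ⟨v, hv, rfl⟩, hm⟩ := h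
  refine ⟨v, hv, ?_⟩
  have hrel : rel ≤ tInvMultiples rel w g k :=
    Ideal.map_le_iff_le_comap.mp (le_sup_left.trans le_sup_left)
  rwa [← map_mul, ← Ideal.mem_comap, Ideal.comap_map_mk hrel] at hm

/-! ### Comparing leading monomials -/

theorem MvPolynomial.X_pow_dvd_iff {V R : Type*} [CommRing R] {x : V} {k : ℕ}
    {r : MvPolynomial V R} : MvPolynomial.X x ^ k ∣ r ↔ ∀ n ∈ r.support, k ≤ n x := by
  rw [MvPolynomial.X_pow_eq_monomial, MvPolynomial.monomial_one_dvd_iff_modMonomial_eq_zero]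
  constructor
  · intro h n hn
    by_contra hlt
    rw [MvPolynomial.mem_support_iff, ← MvPolynomial.coeff_modMonomial_of_not_le r
      (mt Finsupp.single_le_iff.mp hlt), h] at hn
    exact hn (MvPolynomial.coeff_zero n)
  · intro h
    ext n
    rw [MvPolynomial.coeff_zero]
    by_cases hle : Finsupp.single x k ≤ n
    · exact MvPolynomial.coeff_modMonomial_of_le r hle
    · rw [MvPolynomial.coeff_modMonomial_of_not_le r hle]
      by_contra hn
      exact hle (Finsupp.single_le_iff.mpr (h n (MvPolynomial.mem_support_iff.mpr hn)))

/-- A polynomial whose leading monomial is not the leading monomial of an element of `J` is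
divisible by `t⁻ᵏ` as soon as a unit multiple of it is congruent to a multiple of `t⁻ᵏ`. -/
theorem pow_tInv_dvd_of_sub_mem (hord : ord.TInvLocal)
    {J : Ideal (MvPolynomial (ReesVar σ ι) K)} {r v h : MvPolynomial (ReesVar σ ι) K} {k : ℕ}
    (hr : ∀ m, ord.IsLeading r m → ¬ ∃ j ∈ J, ord.IsLeading j m) (hv : v ∈ ord.unitSubmonoid K)
    (hJ : v * r - MvPolynomial.X ReesVar.tInv ^ k * h ∈ J) :
    MvPolynomial.X ReesVar.tInv ^ k ∣ r := by
  by_cases hr0 : r = 0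
  · rw [hr0]
    exact dvd_zero _
  obtain ⟨m, hm⟩ := ord.exists_isLeading hr0
  -- If the exponent of `t⁻¹` in `m` is less than `k`, then the multiple of `t⁻ᵏ` cannot affect the
  -- leading monomial.
  have hkm : k ≤ m ReesVar.tInv := by
    by_contra! hlt
    refine hr m hm ⟨_, hJ, MonomialOrdering.IsLeading.sub ?_ fun n hn => hord m n ?_⟩
    · rw [← zero_add m]
      exact MonomialOrdering.IsLeading.mul hv hm
    · exact hlt.trans_le (MvPolynomial.X_pow_dvd_iff.mp (dvd_mul_right _ _) n hn)
  refine MvPolynomial.X_pow_dvd_iff.mpr fun n hn => ?_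
  by_cases hnm : n = m
  · rwa [hnm]
  · by_contra! hlt
    exact MonomialOrdering.lt_asymm (hm.2 n hn hnm) (hord n m (hlt.trans_le hkm))

instance [Finite σ] [Finite ι] : Finite (ReesVar σ ι) := by
  refine Finite.of_surjective (α := Option (σ ⊕ ι))
    (fun | none => .tInv | some (.inl j) => .coord j | some (.inr i) => .gen i) ?_
  rintro (j | _ | i)
  · exact ⟨some (.inl j), rfl⟩
  · exact ⟨none, rfl⟩
  · exact ⟨some (.inr i), rfl⟩

end Rees

theorem theorem2 {σ ι K : Type*} [Field K] [Finite σ]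
    (ord : MonomialOrdering (ReesVar σ ι)) (hord : ord.TInvLocal)
    (rel : Ideal (MvPolynomial σ K)) (I : Ideal (PresentedRing ord rel))
    (w : ι → ℕ) (g : ι → MvPolynomial σ K) (hg : IsReesSystem ord rel I w g)
    (f : PresentedRing ord rel) :
    (Finite ι → ∃ r, IsNormalForm ord rel (reesIdeal rel w g) f r) ∧
    ∀ r, IsNormalForm ord rel (reesIdeal rel w g) f r →
      ∀ k : ℕ, f ∈ idealClosure (I ^ k) ↔
        (MvPolynomial.X ReesVar.tInv ^ k : MvPolynomial (ReesVar σ ι) K) ∣ r := by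
  refine ⟨fun _ => ?_, ?_⟩
  · obtain ⟨⟨a, ⟨_, v, hv, rfl⟩⟩, ha⟩ :=
      IsLocalization.surj ((baseUnits K ord).map (Ideal.Quotient.mk rel)) f
    obtain ⟨p, rfl⟩ := Ideal.Quotient.mk_surjective a
    obtain ⟨u, hu, r, hur, hr⟩ := ord.exists_weak_normalForm (reesIdeal rel w g) (liftPoly ι p)
    exact ⟨r, ⟨u, hu, v, hv, p, by rw [mul_comm]; exact ha, hur⟩, hr⟩
  · rintro r ⟨⟨u, hu, v, hv, p, hvp, hur⟩, hr⟩ k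
    have hfp : f ∈ idealClosure (I ^ k) ↔ toPresentedRing ord rel p ∈ idealClosure (I ^ k) := by
      rw [← hvp, Ideal.unit_mul_mem_iff_mem _ (isUnit_toPresentedRing hv)]
    rw [hfp]
    constructor
    · intro hp
      obtain ⟨v', hv', hmem⟩ := exists_mul_mem_tInvMultiples hg hp
      obtain ⟨j, hj, s, hs, hjs⟩ := Submodule.mem_sup.mp (Ideal.mem_comap.mp hmem)
      obtain ⟨h, rfl⟩ := Ideal.mem_span_singleton.mp hs
      refine pow_tInv_dvd_of_sub_mem (v := liftPoly ι v') (h := u * h) hord hr hv' ?_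
      rw [map_mul] at hjs
      -- `v' r ≡ v' u p ≡ t⁻ᵏ u h` modulo the relations.
      have h1 := (reesIdeal rel w g).sub_mem ((reesIdeal rel w g).mul_mem_left u hj)
        ((reesIdeal rel w g).mul_mem_left (liftPoly ι v') hur)
      convert h1 using 1
      linear_combination -u * hjs
    · rintro ⟨s, rfl⟩
      exact mem_idealClosure_of_sub_mem hg hu hur
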